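/- Let $R$ be a (commutative Noetherian) regular ring of Krull dimension $\ell<\infty$ all of whose maximal ideals have height $\ell$ (for example a regular local ring, or the coordinate ring of an $\ell$-dimensional smooth affine variety). Let $M$ be a finitely generated reflexive non-free $R$-module, write $M^\vee=\operatorname{Hom}_R(M,R)$, and suppose that the non-free locus $\{\mathfrak p\in\operatorname{Spec}R : M_{\mathfrak p}\text{ is not a free }R_{\mathfrak p}\text{-module}\}$ of $M$ is non-empty of dimension $c$. Then $$\operatorname{pd}_R M+\operatorname{pd}_R M^\vee\ \ge\ \ell-1-c .$$ In case of equality, setting $d=\operatorname{pd}_R M$, the module $M$ is $d$-spherical and $M^\vee$ is $(\ell-d-1-c)$-spherical. Here an $R$-module $N$ is called $p$-spherical if $\operatorname{pd}_R N\le p$ and $\operatorname{Ext}^i_R(N,R)=0$ for $1\le i\le p-1$. -/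

import Mathlib

open CategoryTheory CategoryTheory.Abelian

universe u

/-- The non-free locus of `M`: the set of primes `p` of `R` such that the localization `M_p`
is not a free `R_p`-module. -/
def nonFreeLocus (R : Type u) [CommRing R] (M : Type u) [AddCommGroup M] [Module R M] :
    Set (PrimeSpectrum R) :=
  (Module.freeLocus R M)ᶜ

/-- The projective dimension `pd_R M`; it is `⊥` for the zero module and `⊤` if there is no finite
projective resolution. -/
noncomputable def projDim (R : Type u) [CommRing R] (M : Type u) [AddCommGroup M] [Module R M] :
    WithBot ℕ∞ :=
  projectiveDimension (ModuleCat.of R M)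

/-- `M` is `p`-spherical if `pd_R M ≤ p` and `Ext^i_R(M, R) = 0` for `1 ≤ i ≤ p - 1`. -/
def IsSpherical (R : Type u) [CommRing R] (M : Type u) [AddCommGroup M] [Module R M] (p : ℕ) :
    Prop :=
  projDim R M ≤ (p : WithBot ℕ∞) ∧
    ∀ i : ℕ, 1 ≤ i → i < p → Subsingleton (Ext (ModuleCat.of R M) (ModuleCat.of R R) i)

/-! Write `n = l - c`, `d = pd M`, `e = pd M^∨`. Every `Ext^j(M, R)` with `j ≥ 1` is supported on
the non-free locus, hence has dimension at most `c`. The ring is regular and equidimensional at its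
maximal ideals, so Ischebeck's argument shows that these modules have grade at least `n`.

The core is `Module.subsingleton_ext_of_hasProjectiveDimensionLE_dual`. Let `K` be a syzygy of `M`
in a finite free `F`, and let `B` be the image of `F^∨` in `K^∨`. Then `pd B ≤ e + 1`, and `0 → B →
K^∨ → Ext^1(M, R) → 0` is exact. If `e + 2 < n`, the grade bound makes this sequence split; but
`Ext^1(M, R)` has no nonzero map to `R`, so none to `K^∨`, and it vanishes. Now `K^∨ = B`, and the
argument repeats for `K` with `e + 1`.

If `d + e + 1 < n`, all `Ext^j(M, R)` with `1 ≤ j ≤ d` vanish and `M` is projective, a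
contradiction. In case of equality only `Ext^d` escapes, so `M` is spherical; reflexivity gives the
same for `M^∨`. -/

/-! ### Regular local rings -/

open IsLocalRing in
/-- The quotient of a regular local ring by an element of `𝔪 \ 𝔪²` is regular, of dimension one
less. -/
theorem IsRegularLocalRing.quotient_span_singleton {A : Type*} [CommRing A] [IsRegularLocalRing A]
    {n : ℕ} (hdim : ringKrullDim A = (n + 1 : ℕ)) {x : A} (hx : x ∈ maximalIdeal A)
    (hx2 : x ∉ maximalIdeal A ^ 2) :
    IsRegularLocalRing (A ⧸ Ideal.span {x}) ∧ ringKrullDim (A ⧸ Ideal.span {x}) = n := by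
  classical
  have hne : Ideal.span {x} ≠ ⊤ := fun h ↦
    (maximalIdeal.isMaximal A).ne_top
      (top_le_iff.mp (h ▸ (Ideal.span_singleton_le_iff_mem _).mpr hx))
  have : Nontrivial (A ⧸ Ideal.span {x}) := Ideal.Quotient.nontrivial_iff.mpr hne
  have : IsLocalRing (A ⧸ Ideal.span {x}) :=
    .of_surjective' (Ideal.Quotient.mk _) Ideal.Quotient.mk_surjective
  have hmap : (maximalIdeal A).map (Ideal.Quotient.mk (Ideal.span {x})) =
      maximalIdeal (A ⧸ Ideal.span {x}) :=
    (((local_hom_TFAE (Ideal.Quotient.mk (Ideal.span {x}))).out 0 4).mp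
      (IsLocalHom.of_surjective _ Ideal.Quotient.mk_surjective) ▸ Ideal.map_comap_of_surjective _
      Ideal.Quotient.mk_surjective _)
  obtain ⟨s, hcard, hspan⟩ :=
    Submodule.FG.exists_span_finset_card_eq_spanFinrank
      (maximalIdeal A).fg_of_isNoetherianRing
  have hcard' : s.card = n + 1 := by
    have := (isRegularLocalRing_iff A).mp ‹_›
    rw [hdim, ← hcard] at this
    exact_mod_cast this
  obtain ⟨a, -, ha⟩ := Submodule.mem_span_finset.mp (hspan.symm ▸ hx)
  -- As `x ∉ 𝔪²`, some coefficient of `x` in the minimal generators is a unit, so that generator is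
  -- redundant modulo `x`.
  obtain ⟨y, hy, hay⟩ : ∃ y ∈ s, a y ∉ maximalIdeal A := by
    by_contra! h
    refine hx2 (ha ▸ Ideal.sum_mem _ fun i hi ↦ ?_)
    rw [pow_two]
    exact Ideal.mul_mem_mul (h i hi) (hspan ▸ Submodule.subset_span hi)
  have hle : (maximalIdeal (A ⧸ Ideal.span {x})).spanFinrank ≤ n := by
    have key : maximalIdeal (A ⧸ Ideal.span {x}) =
        Submodule.span _ (((s.erase y).image (Ideal.Quotient.mk (Ideal.span {x})) : Finset _) :
          Set (A ⧸ Ideal.span {x})) := by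
      rw [← hmap, ← hspan]
      change Ideal.map _ (Ideal.span _) = Ideal.span _
      rw [Ideal.map_span]
      apply le_antisymm
      · rw [Ideal.span_le]
        rintro _ ⟨z, hz, rfl⟩
        by_cases hzy : z = y
        · subst hzy
          have h0 : Ideal.Quotient.mk (Ideal.span {x}) x = 0 :=
            Ideal.Quotient.eq_zero_iff_mem.mpr (Ideal.mem_span_singleton_self x)
          have h1 := congrArg (Ideal.Quotient.mk (Ideal.span {x}))
            ((Finset.add_sum_erase _ _ hy).trans ha)
          rw [h0, map_add, smul_eq_mul, map_mul] at h1
          have hu : IsUnit (Ideal.Quotient.mk (Ideal.span {x}) (a z)) :=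
            (not_not.mp (mt (mem_maximalIdeal _).mpr hay)).map _
          have hmem := Ideal.neg_mem_iff _ |>.mpr (show Ideal.Quotient.mk (Ideal.span {x})
            (∑ i ∈ s.erase z, a i • i) ∈ Ideal.span (((s.erase z).image
              (Ideal.Quotient.mk (Ideal.span {x})) : Finset _) : Set (A ⧸ Ideal.span {x})) by
            rw [map_sum]
            refine Ideal.sum_mem _ fun i hi ↦ ?_
            rw [smul_eq_mul, map_mul]
            exact Ideal.mul_mem_left _ _ (Ideal.subset_span (by
              simpa using ⟨i, by simpa [and_comm] using hi, rfl⟩)))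
          rw [← eq_neg_of_add_eq_zero_left h1] at hmem
          exact (Ideal.unit_mul_mem_iff_mem _ hu).mp hmem
        · exact Ideal.subset_span (by
            simpa using ⟨z, ⟨hz, hzy⟩, rfl⟩)
      · exact Ideal.span_mono (by
          rw [Finset.coe_image]; exact Set.image_mono (Finset.erase_subset _ _))
    rw [key]
    refine (Submodule.spanFinrank_span_le_ncard_of_finite (Finset.finite_toSet _)).trans ?_
    rw [Set.ncard_coe_finset]
    exact Finset.card_image_le.trans (by rw [Finset.card_erase_of_mem hy]; omega)
  -- Killing one element lowers the dimension by at most one, so embedding dimension `≤ n ≤` Krull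
  -- dimension.
  have hge : ((n : ℕ) : WithBot ℕ∞) ≤ ringKrullDim (A ⧸ Ideal.span {x}) := by
    have h1 := ringKrullDim_le_ringKrullDim_quotient_add_spanFinrank (Ideal.span {x})
      ((le_maximalIdeal hne).trans (ringJacobson_eq_maximalIdeal A).ge)
    have h2 : (Ideal.span {x}).spanFinrank ≤ 1 := by
      simpa using Submodule.spanFinrank_span_le_ncard_of_finite (R := A) (Set.finite_singleton x)
    have h3 : ((n + 1 : ℕ) : WithBot ℕ∞) ≤ ringKrullDim (A ⧸ Ideal.span {x}) + (1 : ℕ) :=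
      hdim ▸ h1.trans (by gcongr)
    rw [Nat.cast_add] at h3
    exact (ENat.WithBot.add_le_add_natCast_right_iff).mp h3
  have hreg : IsRegularLocalRing (A ⧸ Ideal.span {x}) :=
    .of_spanFinrank_maximalIdeal_le _ (le_trans (by exact_mod_cast hle) hge)
  exact ⟨hreg, le_antisymm ((isRegularLocalRing_iff _).mp hreg ▸ by exact_mod_cast hle) hge⟩

-- By Nakayama, `𝔪 = 𝔪²` forces `𝔪 = 0`, and a field has dimension zero.
open IsLocalRing in
theorem IsRegularLocalRing.not_maximalIdeal_le_sq {A : Type*} [CommRing A] [IsLocalRing A]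
    [IsNoetherianRing A] {n : ℕ} (hdim : ringKrullDim A = (n + 1 : ℕ)) :
    ¬ maximalIdeal A ≤ maximalIdeal A ^ 2 := by
    intro hle
    have h0 : maximalIdeal A = ⊥ := Submodule.eq_bot_of_le_smul_of_le_jacobson_bot
      (maximalIdeal A) _ (maximalIdeal A).fg_of_isNoetherianRing
      (by rwa [pow_two] at hle) (maximalIdeal_le_jacobson _)
    have hf := isField_iff_maximalIdeal_eq.mpr h0
    rw [ringKrullDim_eq_zero_of_isField hf] at hdim
    have : (0 : ℕ) = n + 1 := by exact_mod_cast hdim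
    omega

open IsLocalRing in
/-- A regular local ring is a domain. -/
theorem IsRegularLocalRing.isDomain_of_ringKrullDim_eq (n : ℕ) (A : Type*) [CommRing A]
    [IsRegularLocalRing A] (hdim : ringKrullDim A = n) : IsDomain A := by
  classical
  induction n generalizing A with
  | zero =>
    have h := (isRegularLocalRing_iff A).mp ‹_›
    rw [hdim] at h
    have h0 : maximalIdeal A = ⊥ := (Submodule.spanFinrank_eq_zero_iff_eq_bot
      (maximalIdeal A).fg_of_isNoetherianRing).mp (by exact_mod_cast h)
    exact (isField_iff_maximalIdeal_eq.mpr h0).isDomain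
  | succ n ih =>
    have hfin : (minimalPrimes A).Finite := minimalPrimes.finite_of_isNoetherianRing A
    have hm2 := IsRegularLocalRing.not_maximalIdeal_le_sq hdim
    -- Prime avoidance for the minimal primes together with `𝔪²`, which is the permitted non-prime
    -- exception.
    obtain ⟨x, hx, hx'⟩ : ∃ x ∈ maximalIdeal A,
        x ∉ ⋃ i ∈ (insert (maximalIdeal A ^ 2) hfin.toFinset : Finset (Ideal A)),
          ((id i : Ideal A) : Set A) := by
      by_contra! h
      obtain ⟨i, hi, hle⟩ := (Ideal.subset_union_prime (maximalIdeal A ^ 2)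
        (maximalIdeal A ^ 2) (fun i hi h1 _ ↦ by
          have : i ∈ minimalPrimes A := by simpa [h1] using hi
          exact this.1.1)).mp h
      simp only [Finset.mem_insert, Set.Finite.mem_toFinset] at hi
      rcases hi with rfl | hi
      · exact hm2 hle
      · have := hi.1.1
        have hmi : maximalIdeal A = i := le_antisymm hle (le_maximalIdeal this.ne_top)
        have h0 : (maximalIdeal A).height = 0 := by
          rwa [hmi, Ideal.height_eq_zero_iff]
        have := maximalIdeal_height_eq_ringKrullDim (R := A)
        rw [h0, hdim] at this
        have : (0 : ℕ) = n + 1 := by exact_mod_cast this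
        omega
    simp only [Set.mem_iUnion, not_exists, Finset.mem_insert, id,
      Set.Finite.mem_toFinset, SetLike.mem_coe] at hx'
    have hx2 := hx' _ (Or.inl rfl)
    obtain ⟨hreg, hd⟩ := IsRegularLocalRing.quotient_span_singleton hdim hx hx2
    have := ih _ hd
    have hprime : (Ideal.span {x}).IsPrime := (Ideal.Quotient.isDomain_iff_prime _).mp this
    obtain ⟨p, hp, hpx⟩ := Ideal.exists_minimalPrimes_le (bot_le (a := Ideal.span {x}))
    have hxp : x ∉ p := hx' p (Or.inr hp)
    have hpprime : p.IsPrime := hp.1.1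
    -- Since `p ⊆ (x)` is prime and `x ∉ p`, one has `p = xp`; Nakayama applies.
    have hp0 : p = ⊥ := by
      refine Submodule.eq_bot_of_le_smul_of_le_jacobson_bot (maximalIdeal A) _
        p.fg_of_isNoetherianRing (fun y hy ↦ ?_) (maximalIdeal_le_jacobson _)
      obtain ⟨a, rfl⟩ := Ideal.mem_span_singleton'.mp (hpx hy)
      have ha : a ∈ p := (hpprime.mem_or_mem hy).resolve_right hxp
      rw [mul_comm, smul_eq_mul]
      exact Ideal.mul_mem_mul hx ha
    subst hp0
    exact IsDomain.of_bot_isPrime A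

/-! ### Vanishing of `Ext^i(R/m, R)` below the height of `m` -/

theorem ModuleCat.shortExact_of_function_exact {R : Type u} [Ring R] {M N P : Type u}
    [AddCommGroup M] [Module R M] [AddCommGroup N] [Module R N] [AddCommGroup P] [Module R P]
    {f : M →ₗ[R] N} {g : N →ₗ[R] P} (hf : Function.Injective f) (hg : Function.Surjective g)
    (h : Function.Exact f g) :
    (ModuleCat.shortComplexOfCompEqZero f g h.linearMap_comp_eq_zero).ShortExact where
  exact := ModuleCat.shortComplex_exact _ h
  mono_f := (ModuleCat.mono_iff_injective _).mpr hf
  epi_g := (ModuleCat.epi_iff_surjective _).mpr hg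


section CommRing

variable {R : Type u} [CommRing R]

theorem CategoryTheory.Abelian.Ext.smul_eq_zero_of_mem_annihilator {N L : ModuleCat.{u} R} {r : R}
    (hr : r ∈ Module.annihilator R N) {i : ℕ} (x : Ext N L i) : r • x = 0 := by
  have h0 : r • 𝟙 N = 0 := by
    ext y
    exact Module.mem_annihilator.mp hr y
  rw [← Ext.mk₀_id_comp x, ← Ext.smul_comp, ← Ext.mk₀_smul, h0, Ext.mk₀_zero, Ext.zero_comp]

theorem CategoryTheory.Abelian.Ext.subsingleton_of_shortExact_covariant₁
    {N : ModuleCat.{u} R} {S : ShortComplex (ModuleCat.{u} R)} (hS : S.ShortExact) {i : ℕ}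
    (h : ∀ j, j + 1 = i → Subsingleton (Ext N S.X₃ j))
    (h0 : ∀ x : Ext N S.X₁ i, x.comp (Ext.mk₀ S.f) (add_zero i) = 0) :
    Subsingleton (Ext N S.X₁ i) := by
  refine subsingleton_of_forall_eq 0 fun x ↦ ?_
  cases i with
  | zero =>
    have := hS.mono_f
    exact Ext.postcomp_mk₀_injective_of_mono N S.f (by simpa using h0 x)
  | succ j =>
    obtain ⟨y, rfl⟩ := Ext.covariant_sequence_exact₁ N hS x (h0 x) rfl
    have := h j rfl
    rw [Subsingleton.elim y 0, Ext.zero_comp]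

open IsLocalRing in
/-- If a regular local `R`-algebra `A` of dimension `n` has maximal ideal `IA`, then
`Ext^i_R(R/I, A)` vanishes for `i < n`. -/
theorem IsRegularLocalRing.subsingleton_ext_quotient (I : Ideal R) (n : ℕ) (A : Type u) [CommRing A]
    [Algebra R A] [IsRegularLocalRing A] (hdim : ringKrullDim A = n)
    (hI : I.map (algebraMap R A) = maximalIdeal A) (i : ℕ) (hi : i < n) :
    Subsingleton (Ext (ModuleCat.of R (R ⧸ I)) (ModuleCat.of R A) i) := by
  induction n generalizing A i with
  | zero => omega
  | succ n ih =>
    obtain ⟨x, hxI, hx2⟩ : ∃ x ∈ I, algebraMap R A x ∉ maximalIdeal A ^ 2 := by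
      by_contra! h
      exact IsRegularLocalRing.not_maximalIdeal_le_sq hdim (hI ▸ Ideal.map_le_iff_le_comap.mpr
        (by rw [hI]; exact h))
    have hx : algebraMap R A x ∈ maximalIdeal A := hI ▸ Ideal.mem_map_of_mem _ hxI
    obtain ⟨hreg, hd⟩ := IsRegularLocalRing.quotient_span_singleton hdim hx hx2
    have := IsRegularLocalRing.isDomain_of_ringKrullDim_eq (n + 1) A hdim
    set J := Ideal.span {algebraMap R A x} with hJ
    have hmap : I.map (algebraMap R (A ⧸ J)) = maximalIdeal (A ⧸ J) := by
      rw [IsScalarTower.algebraMap_eq R A (A ⧸ J), ← Ideal.map_map, hI]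
      exact ((local_hom_TFAE (Ideal.Quotient.mk J)).out 0 4).mp
        (IsLocalHom.of_surjective _ Ideal.Quotient.mk_surjective) ▸ Ideal.map_comap_of_surjective _
        Ideal.Quotient.mk_surjective _
    have hx0 : algebraMap R A x ≠ 0 := fun h ↦ hx2 (h ▸ zero_mem _)
    have hexact : Function.Exact (LinearMap.lsmul R A x) (Ideal.Quotient.mkₐ R J).toLinearMap := by
      intro y
      simp only [AlgHom.toLinearMap_apply, Ideal.Quotient.mkₐ_eq_mk, Ideal.Quotient.eq_zero_iff_mem,
        hJ, Ideal.mem_span_singleton', Set.mem_range, LinearMap.lsmul_apply, Algebra.smul_def]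
      simp only [mul_comm]
    have hS := ModuleCat.shortExact_of_function_exact (f := LinearMap.lsmul R A x)
      (g := (Ideal.Quotient.mkₐ R J).toLinearMap) (fun a b h ↦ by
        simp only [LinearMap.lsmul_apply, Algebra.smul_def] at h
        exact mul_left_cancel₀ hx0 h) Ideal.Quotient.mk_surjective hexact
    -- Multiplication by `x` is injective on the domain `A`, yet zero on Ext because `x ∈ I` kills
    -- `R ⧸ I`; induction handles the cokernel `A ⧸ J`. The base ring of Ext stays `R` throughout.
    refine Ext.subsingleton_of_shortExact_covariant₁ hS
      (fun j hj ↦ ih (A ⧸ J) hd hmap j (by omega)) fun y ↦ ?_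
    have hf : (ModuleCat.shortComplexOfCompEqZero (LinearMap.lsmul R A x)
      (Ideal.Quotient.mkₐ R J).toLinearMap hexact.linearMap_comp_eq_zero).f =
        x • 𝟙 (ModuleCat.of R A) := rfl
    rw [hf]
    erw [← Ext.smul_eq_comp_mk₀]
    exact Ext.smul_eq_zero_of_mem_annihilator (by simpa [Ideal.annihilator_quotient] using hxI) y

theorem CategoryTheory.Abelian.Ext.exists_smul_eq_comp_of_isLocalizedModule (S : Submonoid R)
    {F L L' : ModuleCat.{u} R} [Module.Finite R F] [Module.Projective R F] (φ : L ⟶ L')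
    [IsLocalizedModule S φ.hom] {i : ℕ} (z : Ext F L' i) :
    ∃ (s : S) (g : Ext F L i), g.comp (Ext.mk₀ φ) (add_zero i) = (s : R) • z := by
  cases i with
  | zero =>
    obtain ⟨z, rfl⟩ := Ext.addEquiv₀.symm.surjective z
    have := Module.finitePresentation_of_projective R F
    obtain ⟨h, s, hs⟩ := Module.FinitePresentation.exists_lift_of_isLocalizedModule S φ.hom z.hom
    refine ⟨s, Ext.mk₀ (ModuleCat.ofHom h), ?_⟩
    simp only [Ext.mk₀_comp_mk₀, Ext.addEquiv₀_symm_apply, ← Ext.mk₀_smul]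
    congr 1
    ext y
    exact LinearMap.congr_fun hs y
  | succ i =>
    have : Projective F := (IsProjective.iff_projective F).mp ‹_›
    exact ⟨1, 0, by rw [z.eq_zero_of_projective]; simp⟩

/-- The injectivity half of "Ext of a finite module commutes with localization", proved by dimension
shifting. -/
theorem CategoryTheory.Abelian.Ext.exists_smul_eq_zero_of_isLocalizedModule [IsNoetherianRing R]
    (S : Submonoid R) {N L L' : ModuleCat.{u} R} [Module.Finite R N] (φ : L ⟶ L')
    [IsLocalizedModule S φ.hom] {i : ℕ} (x : Ext N L i)
    (hx : x.comp (Ext.mk₀ φ) (add_zero i) = 0) : ∃ s : S, (s : R) • x = 0 := by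
  induction i generalizing N with
  | zero =>
    obtain ⟨x, rfl⟩ := Ext.addEquiv₀.symm.surjective x
    have h0 : φ.hom ∘ₗ x.hom = φ.hom ∘ₗ (0 : N →ₗ[R] L) := by
      have : x ≫ φ = 0 := by
        apply Ext.addEquiv₀.symm.injective
        simpa using hx
      rw [LinearMap.comp_zero, ← ModuleCat.hom_comp, this]; rfl
    obtain ⟨s, hs⟩ := Module.Finite.exists_smul_of_comp_eq_of_isLocalizedModule S φ.hom _ _ h0
    refine ⟨s, ?_⟩
    have : (s : R) • x = 0 := by
      ext y
      exact LinearMap.congr_fun (hs.trans (smul_zero s)) y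
    rw [Ext.addEquiv₀_symm_apply, ← Ext.mk₀_smul, this, Ext.mk₀_zero]
  | succ i ih =>
    obtain ⟨F, _, _, _, _, f, hf⟩ := Module.exists_finite_presentation R N
    have hS := LinearMap.shortExact_shortComplexKer hf
    obtain ⟨y, rfl⟩ := precomp_extClass_surjective_of_projective_X₂ L hS i x
    change (hS.extClass.comp y (add_comm 1 i)).comp _ _ = 0 at hx
    rw [Ext.comp_assoc_of_third_deg_zero] at hx
    obtain ⟨z, hz⟩ := Ext.contravariant_sequence_exact₁ hS L' _ (add_comm 1 i) hx
    obtain ⟨s, g, hg⟩ := Ext.exists_smul_eq_comp_of_isLocalizedModule S φ z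
    -- Correcting `s • y` by the restriction of `g` makes it die in `L'`; the connecting map ignores
    -- that correction.
    obtain ⟨t, ht⟩ := ih (N := f.shortComplexKer.X₁)
      ((s : R) • y - (Ext.mk₀ f.shortComplexKer.f).comp g (zero_add i)) (by
        rw [sub_eq_add_neg, Ext.add_comp, Ext.neg_comp, Ext.smul_comp, Ext.comp_assoc_of_third_deg_zero, hg, Ext.comp_smul, hz,
          add_neg_cancel])
    refine ⟨t * s, ?_⟩
    have h2 : hS.extClass.comp ((t : R) • ((s : R) • y -
      (Ext.mk₀ f.shortComplexKer.f).comp g (zero_add i))) (add_comm 1 i) = 0 := by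
      rw [ht, Ext.comp_zero]
    rw [Ext.comp_smul, sub_eq_add_neg, Ext.comp_add, Ext.comp_neg, Ext.comp_smul,
        hS.extClass_comp_assoc, neg_zero, add_zero,
      smul_smul] at h2
    exact h2

/-- Over a regular ring, `Ext^i(R/m, R)` vanishes below the height of the maximal ideal `m`. -/
theorem IsRegularRing.subsingleton_ext_quotient_of_isMaximal [IsRegularRing R] (m : Ideal R)
    [hm : m.IsMaximal] {n : ℕ} (hn : m.height = n) (i : ℕ) (hi : i < n) :
    Subsingleton (Ext (ModuleCat.of R (R ⧸ m)) (ModuleCat.of R R) i) := by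
  refine subsingleton_of_forall_eq 0 fun x ↦ ?_
  let A := Localization.AtPrime m
  have hdim : ringKrullDim A = n := by
    rw [IsLocalization.AtPrime.ringKrullDim_eq_height m, hn]; rfl
  have h1 := IsRegularLocalRing.subsingleton_ext_quotient m n A hdim
    (Localization.AtPrime.map_eq_maximalIdeal) i hi
  have : IsLocalizedModule m.primeCompl
      (ModuleCat.ofHom (Algebra.linearMap R A)).hom :=
    inferInstanceAs (IsLocalizedModule m.primeCompl (Algebra.linearMap R A))
  obtain ⟨s, hs⟩ := Ext.exists_smul_eq_zero_of_isLocalizedModule m.primeCompl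
    (ModuleCat.ofHom (Algebra.linearMap R A)) x (Subsingleton.elim _ _)
  -- Both `s ∉ m` and all of `m` kill the class, and together they generate the unit ideal.
  obtain ⟨a, b, hb, hab⟩ := hm.exists_inv s.2
  rw [← one_smul R x, ← hab, add_smul, mul_smul, hs, smul_zero, zero_add]
  exact Ext.smul_eq_zero_of_mem_annihilator (by simpa [Ideal.annihilator_quotient] using hb) x

/-! ### Ischebeck's theorem -/

theorem CategoryTheory.Abelian.Ext.subsingleton_of_retract {X Y : ModuleCat.{u} R}
    (h : Retract X Y) {L : ModuleCat.{u} R} {i : ℕ} [Subsingleton (Ext Y L i)] :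
    Subsingleton (Ext X L i) := by
  refine subsingleton_of_forall_eq 0 fun x ↦ ?_
  rw [← x.mk₀_id_comp, ← h.retract, ← Ext.mk₀_comp_mk₀, Ext.comp_assoc_of_second_deg_zero,
    Subsingleton.elim ((Ext.mk₀ h.r).comp x (zero_add i)) 0, Ext.comp_zero]

theorem CategoryTheory.Abelian.Ext.exists_smul_eq_of_isSMulRegular {M L : ModuleCat.{u} R} {x : R}
    (hx : IsSMulRegular M x) {i : ℕ}
    (h : Subsingleton (Ext (ModuleCat.of R (QuotSMulTop x M)) L (i + 1))) (y : Ext M L i) :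
    ∃ z : Ext M L i, x • z = y := by
  obtain ⟨z, hz⟩ := Ext.contravariant_sequence_exact₁ hx.smulShortComplex_shortExact _ y
    (add_comm 1 i) (h.elim _ _)
  refine ⟨z, ?_⟩
  rw [← hz, ModuleCat.smulShortComplex_f_eq_smul_id]
  erw [Ext.mk₀_smul, Ext.smul_comp, Ext.mk₀_id_comp]
  rfl

/-- A form of Ischebeck's theorem: if `Ext^i(R/m, R)` vanishes for all maximal ideals `m` and
all `i < l`, then `Ext^i(N, R)` vanishes whenever `i + dim N < l`. -/
theorem Module.subsingleton_ext_of_supportDim_lt [IsNoetherianRing R] (l : ℕ)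
    (h : ∀ m : Ideal R, m.IsMaximal → ∀ i < l,
      Subsingleton (Ext (ModuleCat.of R (R ⧸ m)) (ModuleCat.of R R) i))
    (k i : ℕ) (hik : i + k = l) (N : Type u) [AddCommGroup N] [Module R N] [Module.Finite R N]
    (hN : Module.supportDim R N < k) :
    Subsingleton (Ext (ModuleCat.of R N) (ModuleCat.of R R) i) := by
  induction k generalizing i N with
  | zero =>
    have : Subsingleton N := by
      rw [← Module.supportDim_eq_bot_iff_subsingleton (R := R)]
      exact WithBot.lt_coe_bot.mp hN
    have hz : Limits.IsZero (ModuleCat.of R N) := ModuleCat.isZero_of_subsingleton _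
    have := hz.hasProjectiveDimensionLT_zero
    exact HasProjectiveDimensionLT.subsingleton _ 0 i (Nat.zero_le _) _
  | succ k ih =>
    revert hN
    induction ‹Module.Finite R N› using
      IsNoetherianRing.induction_on_isQuotientEquivQuotientPrime R with
    | subsingleton N =>
      intro _
      have hz : Limits.IsZero (ModuleCat.of R N) := ModuleCat.isZero_of_subsingleton _
      have := hz.hasProjectiveDimensionLT_zero
      exact HasProjectiveDimensionLT.subsingleton _ 0 i (Nat.zero_le _) _
    | exact N₁ N₂ N₃ f g hf hg hfg h₁ h₃ =>
      intro hN
      have h₁ := h₁ ((Module.supportDim_le_of_injective f hf).trans_lt hN)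
      have h₃ := h₃ ((Module.supportDim_le_of_surjective g hg).trans_lt hN)
      refine subsingleton_of_forall_eq 0 fun x ↦ ?_
      obtain ⟨y, rfl⟩ := Ext.contravariant_sequence_exact₂
        (ModuleCat.shortExact_of_function_exact hf hg hfg) _ x (h₁.elim _ _)
      rw [h₃.elim y 0, Ext.comp_zero]
    | quotient N p e =>
      intro hN
      rw [Module.supportDim_eq_of_equiv e] at hN
      suffices hs : Subsingleton (Ext (ModuleCat.of R (R ⧸ p.1)) (ModuleCat.of R R) i) from
        Ext.subsingleton_of_retract e.toModuleIso.retract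
      have hp := p.2
      by_cases hpm : p.1.IsMaximal
      · exact h p.1 hpm i (by omega)
      set E := Ext (ModuleCat.of R (R ⧸ p.1)) (ModuleCat.of R R) i
      by_contra hns
      have hann : Module.annihilator R E ≠ ⊤ := by
        rwa [Ne, Module.annihilator_eq_top_iff]
      obtain ⟨m, hm, hEm⟩ := Ideal.exists_le_maximal _ hann
      have hpE : p.1 ≤ Module.annihilator R E := fun r hr ↦
        Module.mem_annihilator.mpr fun y ↦
          Ext.smul_eq_zero_of_mem_annihilator (by simpa [Ideal.annihilator_quotient] using hr) y
      -- Passing to `(R/p)/x` lowers the dimension, so `Ext^{i+1}` vanishes there and `xE = E`.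
      -- Nakayama then gives an annihilator of `E` congruent to `1` modulo `x`, contradicting `x ∈
      -- m` and `Ann E ⊆ m`.
      obtain ⟨x, hxm, hxp⟩ : ∃ x ∈ m, x ∉ p.1 := by
        by_contra! hle
        exact hpm ((le_antisymm hle (hpE.trans hEm)) ▸ hm)
      have hreg : IsSMulRegular (R ⧸ p.1) x := by
        intro a b hab
        simp only [Algebra.smul_def] at hab
        exact mul_left_cancel₀ (by simpa [Ideal.Quotient.eq_zero_iff_mem] using hxp) hab
      have hdim : Module.supportDim R (QuotSMulTop x (R ⧸ p.1)) < k := by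
        have h1 := Module.supportDim_quotSMulTop_succ_le_of_notMem_minimalPrimes
          (R := R) (M := R ⧸ p.1) (x := x)
          (by rw [Ideal.annihilator_quotient, Ideal.minimalPrimes_eq_subsingleton_self]; simpa)
        have h2 := h1.trans_lt hN
        rw [Nat.cast_add, Nat.cast_one] at h2
        exact lt_of_add_lt_add_right h2
      have hnext := ih (i + 1) (by omega) (QuotSMulTop x (R ⧸ p.1)) hdim
      have hsurj : (⊤ : Submodule R E) ≤ Ideal.span {x} • ⊤ := fun y _ ↦ by
        obtain ⟨z, rfl⟩ := Ext.exists_smul_eq_of_isSMulRegular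
          (M := ModuleCat.of R (R ⧸ p.1)) hreg hnext y
        exact Submodule.smul_mem_smul (Ideal.mem_span_singleton_self x) trivial
      obtain ⟨r, hr1, hr⟩ := Submodule.exists_sub_one_mem_and_smul_eq_zero_of_fg_of_le_smul
        (Ideal.span {x}) (⊤ : Submodule R E) Module.Finite.fg_top hsurj
      have hrm : r ∈ m := hEm (Module.mem_annihilator.mpr fun y ↦ hr y trivial)
      refine hm.ne_top ((Ideal.eq_top_iff_one m).mpr ?_)
      have := m.sub_mem hrm ((Ideal.span_singleton_le_iff_mem _).mpr hxm hr1)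
      simpa using this

/-! ### Ext and projective dimension -/

/-- Vanishing of `Ext^i(X, R)` implies vanishing of `Ext^i(X, B)` for `B` finite projective. -/
theorem CategoryTheory.Abelian.Ext.subsingleton_of_projective_of_finite {X B : ModuleCat.{u} R}
    [Module.Finite R B] [Module.Projective R B] {i : ℕ}
    (h : Subsingleton (Ext X (ModuleCat.of R R) i)) : Subsingleton (Ext X B i) := by
  refine subsingleton_of_forall_eq 0 fun x ↦ ?_
  obtain ⟨n, f, g, -, -, hfg⟩ := Module.Finite.exists_comp_eq_id_of_projective R B
  have hid : 𝟙 B = ∑ j : Fin n, ModuleCat.ofHom (LinearMap.proj j ∘ₗ g) ≫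
      ModuleCat.ofHom (f ∘ₗ LinearMap.single R (fun _ ↦ R) j) := by
    ext y
    have h1 : ∑ j, f (Pi.single j (g y j)) = y := by
      rw [← map_sum, Finset.univ_sum_single]
      exact LinearMap.congr_fun hfg y
    simpa [ModuleCat.hom_sum] using h1.symm
  rw [← x.comp_mk₀_id, hid, Ext.mk₀_sum, Ext.comp_sum]
  refine Finset.sum_eq_zero fun j _ ↦ ?_
  rw [← Ext.mk₀_comp_mk₀, ← Ext.comp_assoc_of_third_deg_zero, h.elim (x.comp _ _) 0, Ext.zero_comp]

/-- If `Ext^i(X, R)` vanishes for `i < n`, then `Ext^i(X, B)` vanishes for `i < n - pd B`. -/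
theorem CategoryTheory.Abelian.Ext.subsingleton_of_hasProjectiveDimensionLE [IsNoetherianRing R]
    {X : ModuleCat.{u} R} {n : ℕ} (h : ∀ i < n, Subsingleton (Ext X (ModuleCat.of R R) i))
    (e : ℕ) (B : ModuleCat.{u} R) [Module.Finite R B] (hB : HasProjectiveDimensionLE B e)
    (i : ℕ) (hi : i + e < n) : Subsingleton (Ext X B i) := by
  induction e generalizing B i with
  | zero =>
    have : Module.Projective R B := (IsProjective.iff_projective B).mpr
      ((projective_iff_hasProjectiveDimensionLE_zero _).mpr hB)
    exact Ext.subsingleton_of_projective_of_finite (h i hi)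
  | succ e ih =>
    obtain ⟨F, _, _, _, _, f, hf⟩ := Module.exists_finite_presentation R B
    have hS := LinearMap.shortExact_shortComplexKer hf
    have hF := Ext.subsingleton_of_projective_of_finite (B := ModuleCat.of R F) (h i (by omega))
    have hpF : Projective (f.shortComplexKer.X₂) := (IsProjective.iff_projective F).mp inferInstance
    have hK := ih f.shortComplexKer.X₁
      ((hS.hasProjectiveDimensionLT_X₃_iff e hpF).mp hB) (i + 1) (by omega)
    refine subsingleton_of_forall_eq 0 fun x ↦ ?_
    obtain ⟨y, rfl⟩ := Ext.covariant_sequence_exact₃ X hS x rfl (hK.elim _ _)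
    have hy : y = 0 := hF.elim y 0
    rw [hy, Ext.zero_comp]

/-- When `pd M ≤ d`, the functor `Ext^d(M, -)` is right exact, so its vanishing on `R` spreads to
all finite modules. -/
theorem ModuleCat.hasProjectiveDimensionLT_of_subsingleton_ext [IsNoetherianRing R]
    (M : ModuleCat.{u} R) [Module.Finite R M] (d : ℕ) (hM : HasProjectiveDimensionLE M d)
    (h : Subsingleton (Ext M (ModuleCat.of R R) d)) : HasProjectiveDimensionLT M d := by
  refine ModuleCat.hasProjectiveDimensionLT_of_forall_finite M d fun L _ ↦ ?_
  obtain ⟨F, _, _, _, _, f, hf⟩ := Module.exists_finite_presentation R L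
  have hS := LinearMap.shortExact_shortComplexKer hf
  have hF := Ext.subsingleton_of_projective_of_finite (B := ModuleCat.of R F) h
  have hK := HasProjectiveDimensionLT.subsingleton M (d + 1) (d + 1) le_rfl f.shortComplexKer.X₁
  refine subsingleton_of_forall_eq 0 fun x ↦ ?_
  obtain ⟨y, rfl⟩ := Ext.covariant_sequence_exact₃ M hS x rfl (hK.elim _ _)
  have hy : y = 0 := hF.elim y 0
  rw [hy, Ext.zero_comp]

theorem Module.projective_of_subsingleton_ext [IsNoetherianRing R]
    (M : ModuleCat.{u} R) [Module.Finite R M] (d : ℕ) (hM : HasProjectiveDimensionLE M d)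
    (h : ∀ j, 1 ≤ j → j ≤ d → Subsingleton (Ext M (ModuleCat.of R R) j)) :
    Module.Projective R M := by
  induction d with
  | zero =>
    exact (IsProjective.iff_projective (R := R) M).mpr
      ((projective_iff_hasProjectiveDimensionLE_zero _).mpr hM)
  | succ d ih =>
    exact ih (ModuleCat.hasProjectiveDimensionLT_of_subsingleton_ext M (d + 1) hM
      (h _ (by omega) le_rfl)) fun j h1 h2 ↦ h j h1 (by omega)

/-! ### Localizing Ext at the free locus -/

/-- Near a prime of the free locus, a nonzero multiple of the identity factors through a finite
free module. -/
theorem Module.exists_smul_id_factors_of_mem_freeLocus {M : Type u} [AddCommGroup M] [Module R M]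
    [IsNoetherianRing R] [Module.Finite R M] {p : PrimeSpectrum R} (hp : p ∈ Module.freeLocus R M) :
    ∃ r ∉ p.asIdeal, ∃ (F : Type u) (_ : AddCommGroup F) (_ : Module R F) (_ : Module.Free R F)
      (_ : Module.Finite R F) (a : M →ₗ[R] F) (b : F →ₗ[R] M), b ∘ₗ a = r • LinearMap.id := by
  obtain ⟨F, _, _, _, _, f, hf⟩ := Module.exists_finite_presentation R M
  let S := p.asIdeal.primeCompl
  let A := Localization.AtPrime p.asIdeal
  have hfree : Module.Free A (LocalizedModule S M) := hp
  let iF := LocalizedModule.mkLinearMap S F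
  let iM := LocalizedModule.mkLinearMap S M
  let fp := IsLocalizedModule.mapExtendScalars S iF iM A f
  have hfp : Function.Surjective fp := IsLocalizedModule.map_surjective S iF iM f hf
  -- A section of the localized presentation; `s` clears its denominators and `t` turns the local
  -- identity into one over `R`.
  obtain ⟨σ, hσ⟩ := Module.projective_lifting_property fp .id hfp
  have := Module.finitePresentation_of_finite R M
  obtain ⟨g, s, hg⟩ := Module.FinitePresentation.exists_lift_of_isLocalizedModule S iF
    (σ.restrictScalars R ∘ₗ iM)
  have hcomp : iM ∘ₗ (f ∘ₗ g) = iM ∘ₗ ((s : R) • LinearMap.id) := by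
    ext y
    have h1 : iF (g y) = (s : R) • σ (iM y) := LinearMap.congr_fun hg y
    have h2 : iM (f (g y)) = fp (iF (g y)) := (IsLocalizedModule.map_apply S iF iM f _).symm
    have h3 : fp (σ (iM y)) = iM y := LinearMap.congr_fun hσ _
    change iM (f (g y)) = iM ((s : R) • y)
    rw [h2, h1, map_smul iM]
    exact (fp.map_smul_of_tower (s : R) _).trans (by rw [h3])
  obtain ⟨t, ht⟩ := Module.Finite.exists_smul_of_comp_eq_of_isLocalizedModule S iM _ _ hcomp
  refine ⟨t * s, (t * s).2, F, _, _, ‹_›, ‹_›, g, (t : R) • f, ?_⟩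
  rw [LinearMap.smul_comp, mul_smul]
  exact ht

/-- Multiplication by `r` factors through `Ext^{j+1}(F, L) = 0`. -/
theorem CategoryTheory.Abelian.Ext.mem_annihilator_of_factors {M : Type u} [AddCommGroup M]
    [Module R M] {F : Type u} [AddCommGroup F] [Module R F] [Module.Projective R F]
    {a : M →ₗ[R] F} {b : F →ₗ[R] M} {r : R} (h : b ∘ₗ a = r • LinearMap.id)
    (L : ModuleCat.{u} R) (j : ℕ) :
    r ∈ Module.annihilator R (Ext (ModuleCat.of R M) L (j + 1)) := by
  refine Module.mem_annihilator.mpr fun x ↦ ?_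
  have hid : ModuleCat.ofHom a ≫ ModuleCat.ofHom b = r • 𝟙 (ModuleCat.of R M) := by
    ext y
    exact LinearMap.congr_fun h y
  have : Projective (ModuleCat.of R F) := (IsProjective.iff_projective F).mp ‹_›
  rw [← x.mk₀_id_comp, ← Ext.smul_comp, ← Ext.mk₀_smul, ← hid, ← Ext.mk₀_comp_mk₀,
    Ext.comp_assoc_of_second_deg_zero,
    Ext.eq_zero_of_projective ((Ext.mk₀ (ModuleCat.ofHom b)).comp x (zero_add _)), Ext.comp_zero]

/-! ### Duals of syzygies -/

section Syzygy

variable {M F : Type u} [AddCommGroup M] [Module R M] [AddCommGroup F] [Module R F]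
  {f : F →ₗ[R] M}

/-- The connecting map from the dual of the syzygy to `Ext¹(M, R)`. -/
noncomputable def dualKerToExtOne (hf : Function.Surjective f) :
    Module.Dual R (LinearMap.ker f) →ₗ[R] Ext (ModuleCat.of R M) (ModuleCat.of R R) 1 :=
  (LinearMap.shortExact_shortComplexKer hf).extClass.precompOfLinear R (ModuleCat.of R R)
    (add_zero 1) ∘ₗ (Ext.linearEquiv₀ (R := R) (X := ModuleCat.of R (LinearMap.ker f))
      (Y := ModuleCat.of R R)).symm.toLinearMap ∘ₗ
      (ModuleCat.homLinearEquiv (R := R) (S := R) (M := ModuleCat.of R (LinearMap.ker f))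
        (N := ModuleCat.of R R)).symm.toLinearMap

theorem dualKerToExtOne_apply (hf : Function.Surjective f)
    (φ : Module.Dual R (LinearMap.ker f)) :
    dualKerToExtOne hf φ = (LinearMap.shortExact_shortComplexKer hf).extClass.comp
      (Ext.mk₀ (ModuleCat.ofHom φ)) (add_zero 1) := rfl

/-- With the next two results this yields the exact sequence `M^∨ → F^∨ → K^∨ → Ext^1(M, R) → 0`,
where `K = ker f`. -/
theorem dualKerToExtOne_surjective [Module.Projective R F] (hf : Function.Surjective f) :
    Function.Surjective (dualKerToExtOne hf) := fun x ↦ by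
  have : Projective f.shortComplexKer.X₂ := (IsProjective.iff_projective F).mp ‹_›
  obtain ⟨y, rfl⟩ := precomp_extClass_surjective_of_projective_X₂ (ModuleCat.of R R)
    (LinearMap.shortExact_shortComplexKer hf) 0 x
  obtain ⟨y, rfl⟩ := Ext.addEquiv₀.symm.surjective y
  exact ⟨y.hom, rfl⟩

theorem exact_dualMap_dualKerToExtOne (hf : Function.Surjective f) :
    Function.Exact (LinearMap.ker f).subtype.dualMap (dualKerToExtOne hf) := fun φ ↦ by
  rw [dualKerToExtOne_apply]
  refine ⟨fun h ↦ ?_, ?_⟩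
  · obtain ⟨ψ, hψ⟩ := Ext.contravariant_sequence_exact₁
      (LinearMap.shortExact_shortComplexKer hf) _ _ (add_zero 1) h
    obtain ⟨ψ, rfl⟩ := Ext.addEquiv₀.symm.surjective ψ
    refine ⟨ψ.hom, ?_⟩
    rw [Ext.addEquiv₀_symm_apply, Ext.mk₀_comp_mk₀] at hψ
    have := Ext.addEquiv₀.symm.injective hψ
    exact congrArg ModuleCat.Hom.hom this
  · rintro ⟨ψ, rfl⟩
    have h : ModuleCat.ofHom ((LinearMap.ker f).subtype.dualMap ψ) =
      f.shortComplexKer.f ≫ ModuleCat.ofHom ψ := rfl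
    rw [h, ← Ext.mk₀_comp_mk₀, ShortComplex.ShortExact.extClass_comp_assoc]

theorem exact_dualMap_dualMap_subtype (hf : Function.Surjective f) :
    Function.Exact f.dualMap (LinearMap.ker f).subtype.dualMap := by
  intro φ
  refine ⟨fun h ↦ ?_, ?_⟩
  · refine ⟨(LinearMap.ker f).liftQ φ (fun x hx ↦ LinearMap.congr_fun h ⟨x, hx⟩) ∘ₗ
      (f.quotKerEquivOfSurjective hf).symm.toLinearMap, ?_⟩
    ext x
    have : (f.quotKerEquivOfSurjective hf).symm (f x) = (LinearMap.ker f).mkQ x := by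
      rw [LinearEquiv.symm_apply_eq]; rfl
    rw [LinearMap.dualMap_apply, LinearMap.comp_apply, LinearEquiv.coe_coe, this]
    exact Submodule.liftQ_apply _ _ _
  · rintro ⟨ψ, rfl⟩
    ext x
    simp

/-- Dimension shifting `Ext^{j+1}(K, L) ≃ Ext^{j+2}(M, L)` for the syzygy `K` of `M`. -/
noncomputable def extKerEquiv [Module.Projective R F] (hf : Function.Surjective f)
    (L : ModuleCat.{u} R) (j : ℕ) :
    Ext (ModuleCat.of R (LinearMap.ker f)) L (j + 1) ≃ₗ[R] Ext (ModuleCat.of R M) L (j + 1 + 1) :=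
  haveI : Projective f.shortComplexKer.X₂ := (IsProjective.iff_projective F).mp ‹_›
  LinearEquiv.ofBijective
    ((LinearMap.shortExact_shortComplexKer hf).extClass.precompOfLinear R L (add_comm 1 (j + 1)))
    ⟨by
      rw [← LinearMap.ker_eq_bot, LinearMap.ker_eq_bot']
      intro y hy
      obtain ⟨z, rfl⟩ := Ext.contravariant_sequence_exact₁
        (LinearMap.shortExact_shortComplexKer hf) _ y (add_comm 1 (j + 1)) hy
      rw [z.eq_zero_of_projective, Ext.comp_zero],
      precomp_extClass_surjective_of_projective_X₂ L
        (LinearMap.shortExact_shortComplexKer hf) (j + 1)⟩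

end Syzygy

/-! ### The vanishing theorem and the support of Ext -/

/-- If the dual of `M` has projective dimension at most `e` and all `Ext^j(M, R)` with `j ≥ 1` have
grade at least `n`, then `Ext^j(M, R) = 0` for `1 ≤ j < n - e - 1`. -/
theorem Module.subsingleton_ext_of_hasProjectiveDimensionLE_dual [IsNoetherianRing R] (n k e : ℕ)
    (M : Type u) [AddCommGroup M] [Module R M] [Module.Finite R M]
    (hM : ∀ j, ∀ i < n, Subsingleton (Ext (ModuleCat.of R
      (Ext (ModuleCat.of R M) (ModuleCat.of R R) (j + 1))) (ModuleCat.of R R) i))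
    (he : HasProjectiveDimensionLE (ModuleCat.of R (Module.Dual R M)) e) (hk : e + k + 1 < n)
    (j : ℕ) (hj : j < k) : Subsingleton (Ext (ModuleCat.of R M) (ModuleCat.of R R) (j + 1)) := by
  induction k generalizing e M j with
  | zero => omega
  | succ k ih =>
    obtain ⟨F, _, _, _, _, f, hf⟩ := Module.exists_finite_presentation R M
    let K := LinearMap.ker f
    let δ := dualKerToExtOne hf
    have hFd : HasProjectiveDimensionLE (ModuleCat.of R (Module.Dual R F)) 0 :=
      (projective_iff_hasProjectiveDimensionLE_zero _).mp
        ((IsProjective.iff_projective (Module.Dual R F)).mp inferInstance)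
    have hFd' : HasProjectiveDimensionLT (ModuleCat.of R (Module.Dual R F)) (e + 1 + 1) :=
      hasProjectiveDimensionLT_of_ge _ 1 _ (by omega)
    have hinj : Function.Injective f.dualMap := LinearMap.dualMap_injective_of_surjective hf
    -- `ker δ` is the image of `F^∨`, that is, the cokernel of `M^∨ → F^∨`.
    have hB : HasProjectiveDimensionLE (ModuleCat.of R (LinearMap.ker δ)) (e + 1) := by
      have hmem : ∀ ψ, K.subtype.dualMap ψ ∈ LinearMap.ker δ := fun ψ ↦
        (exact_dualMap_dualKerToExtOne hf _).mpr ⟨ψ, rfl⟩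
      let π : Module.Dual R F →ₗ[R] LinearMap.ker δ :=
        K.subtype.dualMap.codRestrict (LinearMap.ker δ) hmem
      have hπ : Function.Surjective π := fun φ ↦ by
        obtain ⟨ψ, hψ⟩ := (exact_dualMap_dualKerToExtOne hf φ.1).mp φ.2
        exact ⟨ψ, Subtype.ext hψ⟩
      have hex : Function.Exact f.dualMap π := fun ψ ↦ by
        rw [← exact_dualMap_dualMap_subtype hf ψ]
        exact Subtype.ext_iff
      have hS := ModuleCat.shortExact_of_function_exact (P := LinearMap.ker δ) (f := f.dualMap)
        (g := π) hinj hπ hex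
      exact hS.hasProjectiveDimensionLT_X₃ (e + 1) he hFd'
    have hE : Subsingleton (Ext (ModuleCat.of R M) (ModuleCat.of R R) 1) := by
      have hS := LinearMap.shortExact_shortComplexKer (dualKerToExtOne_surjective hf)
      have h1 := Ext.subsingleton_of_hasProjectiveDimensionLE (hM 0) (e + 1)
        (ModuleCat.of R (LinearMap.ker δ)) hB 1 (by omega)
      -- The identity of `Ext^1(M, R)` lifts along `δ`, giving a section `σ`; composing `σ` with
      -- evaluation at any `y` gives a map to `R`, which is zero.
      obtain ⟨σ, hσ⟩ := Ext.covariant_sequence_exact₃ (ModuleCat.of R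
        (Ext (ModuleCat.of R M) (ModuleCat.of R R) 1)) hS (Ext.mk₀ (𝟙 _)) (zero_add 1)
        (h1.elim _ _)
      obtain ⟨σ, rfl⟩ := Ext.addEquiv₀.symm.surjective σ
      rw [Ext.addEquiv₀_symm_apply, Ext.mk₀_comp_mk₀] at hσ
      have hσ := Ext.addEquiv₀.symm.injective hσ
      have h0 := hM 0 0 (by omega)
      have hσ0 : ∀ x, σ.hom x = 0 := fun x ↦ by
        refine LinearMap.ext fun y ↦ ?_
        let ev : Ext (ModuleCat.of R M) (ModuleCat.of R R) 1 →ₗ[R] R :=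
          LinearMap.applyₗ y ∘ₗ σ.hom
        have hev : ModuleCat.ofHom ev = 0 := Ext.addEquiv₀.symm.injective (h0.elim _ _)
        exact LinearMap.congr_fun (congrArg ModuleCat.Hom.hom hev) x
      refine subsingleton_of_forall_eq 0 fun x ↦ ?_
      have hx : δ (σ.hom x) = x := LinearMap.congr_fun (congrArg ModuleCat.Hom.hom hσ) x
      rw [← hx, hσ0, map_zero]
    cases j with
    | zero => exact hE
    | succ j =>
      have hK : HasProjectiveDimensionLE (ModuleCat.of R (Module.Dual R K)) (e + 1) := by
        have hS := ModuleCat.shortExact_of_function_exact (f := f.dualMap)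
          (g := K.subtype.dualMap) hinj
          (fun φ ↦ (exact_dualMap_dualKerToExtOne hf φ).mp (hE.elim _ _))
          (exact_dualMap_dualMap_subtype hf)
        exact hS.hasProjectiveDimensionLT_X₃ (e + 1) he hFd'
      -- Passing to the syzygy raises `e` by one and lowers `k` by one, so the bound on `e + k` is
      -- kept.
      have := ih (e + 1) K (fun j i hi ↦ by
        have := hM (j + 1) i hi
        exact Ext.subsingleton_of_retract
          (extKerEquiv hf (ModuleCat.of R R) j).toModuleIso.retract) hK (by omega) j (by omega)
      exact (extKerEquiv hf (ModuleCat.of R R) j).symm.subsingleton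

/-- At a prime of the free locus, some `r` outside it factors through a free module on `M`, and the
dual factorization serves `M^∨`; so one locus bounds both supports. -/
theorem Module.supportDim_ext_le {M : Type u} [AddCommGroup M] [Module R M] [IsNoetherianRing R]
    [Module.Finite R M] (j : ℕ) :
    Module.supportDim R (Ext (ModuleCat.of R M) (ModuleCat.of R R) (j + 1)) ≤
        Order.krullDim ((Module.freeLocus R M)ᶜ : Set (PrimeSpectrum R)) ∧
      Module.supportDim R (Ext (ModuleCat.of R (Module.Dual R M)) (ModuleCat.of R R) (j + 1)) ≤
        Order.krullDim ((Module.freeLocus R M)ᶜ : Set (PrimeSpectrum R)) := by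
  have key : ∀ E : Type u, ∀ [AddCommGroup E] [Module R E] [Module.Finite R E],
      (∀ p ∈ Module.freeLocus R M, ¬ Module.annihilator R E ≤ p.asIdeal) →
      Module.supportDim R E ≤ Order.krullDim ((Module.freeLocus R M)ᶜ : Set (PrimeSpectrum R)) := by
    intro E _ _ _ h
    have hsub : ∀ p ∈ Module.support R E, p ∈ (Module.freeLocus R M)ᶜ := fun p hp hpM ↦ by
      rw [Module.support_eq_zeroLocus] at hp
      exact h p hpM hp
    exact Order.krullDim_le_of_strictMono (fun p ↦ ⟨p.1, hsub p.1 p.2⟩) fun _ _ h ↦ h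
  constructor
  · refine key _ fun p hp hle ↦ ?_
    obtain ⟨r, hr, F, _, _, _, _, a, b, hab⟩ := Module.exists_smul_id_factors_of_mem_freeLocus hp
    exact hr (hle (Ext.mem_annihilator_of_factors hab _ j))
  · refine key _ fun p hp hle ↦ ?_
    obtain ⟨r, hr, F, _, _, _, _, a, b, hab⟩ := Module.exists_smul_id_factors_of_mem_freeLocus hp
    have hab' : a.dualMap ∘ₗ b.dualMap = r • LinearMap.id := by
      ext φ y
      have := congrArg φ (LinearMap.congr_fun hab y)
      simpa using this
    exact hr (hle (Ext.mem_annihilator_of_factors hab' _ j))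

end CommRing

/-! ### The main theorem -/

theorem mainTheorem6 (R : Type u) [CommRing R] [IsRegularRing R] (l : ℕ)
    (hdim : ringKrullDim R = (l : WithBot ℕ∞))
    (hequi : ∀ m : Ideal R, m.IsMaximal → m.height = (l : ℕ∞))
    (M : Type u) [AddCommGroup M] [Module R M] [Module.Finite R M]
    [Module.IsReflexive R M] (hM : ¬ Module.Free R M) (c : ℕ)
    (hc : Order.krullDim (nonFreeLocus R M) = (c : WithBot ℕ∞)) :
    (l : WithBot ℕ∞) ≤ projDim R M + projDim R (Module.Dual R M) + 1 + c ∧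
      ((l : WithBot ℕ∞) = projDim R M + projDim R (Module.Dual R M) + 1 + c →
        ∃ d : ℕ, projDim R M = (d : WithBot ℕ∞) ∧ d + 1 + c ≤ l ∧
          IsSpherical R M d ∧ IsSpherical R (Module.Dual R M) (l - d - 1 - c)) := by
  -- A projective module has empty non-free locus, whose Krull dimension is `⊥` and not `c`.
  have hM' : ¬ Module.Projective R M := fun h ↦ by
    have := Module.finitePresentation_of_finite R M
    rw [nonFreeLocus, Module.freeLocus_eq_univ_iff.mpr h, Set.compl_univ,
      Order.krullDim_eq_bot] at hc
    exact WithBot.bot_ne_natCast c hc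
  have hD' : ¬ Module.Projective R (Module.Dual R M) := fun h ↦
    hM' (Module.Projective.of_equiv (Module.evalEquiv R M).symm)
  have hgrade : ∀ (E : Type u) [AddCommGroup E] [Module R E] [Module.Finite R E],
      Module.supportDim R E ≤ c → ∀ i < l - c,
        Subsingleton (Ext (ModuleCat.of R E) (ModuleCat.of R R) i) := fun E _ _ _ hE i hi ↦
    Module.subsingleton_ext_of_supportDim_lt l
      (fun m hm ↦ IsRegularRing.subsingleton_ext_quotient_of_isMaximal m (hequi m hm))
      (l - i) i (by omega) E (hE.trans_lt (by exact_mod_cast (by omega : c < l - i)))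
  have hdepthM := fun j ↦ hgrade _ (hc ▸ (Module.supportDim_ext_le (R := R) (M := M) j).1)
  have hdepthD := fun j ↦ hgrade _ (hc ▸ (Module.supportDim_ext_le (R := R) (M := M) j).2)
  have cases_pd : ∀ N : Type u, ∀ [AddCommGroup N] [Module R N], ¬ Module.Projective R N →
      projDim R N = ⊤ ∨ ∃ d : ℕ, projDim R N = d := by
    intro N _ _ hN
    generalize hd : projDim R N = d
    induction d with
    | bot =>
      have : Subsingleton N :=
        ModuleCat.isZero_iff_subsingleton.mp ((projectiveDimension_eq_bot_iff _).mp hd)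
      exact absurd (inferInstance : Module.Projective R N) hN
    | coe d =>
      induction d with
      | top => exact Or.inl rfl
      | coe d => exact Or.inr ⟨d, rfl⟩
  -- If a projective dimension is infinite, the inequality is trivial and equality is impossible.
  have htop : projDim R M + projDim R (Module.Dual R M) + 1 + c = ⊤ →
      (l : WithBot ℕ∞) ≤ projDim R M + projDim R (Module.Dual R M) + 1 + c ∧
      ((l : WithBot ℕ∞) = projDim R M + projDim R (Module.Dual R M) + 1 + c →
        ∃ d : ℕ, projDim R M = (d : WithBot ℕ∞) ∧ d + 1 + c ≤ l ∧
          IsSpherical R M d ∧ IsSpherical R (Module.Dual R M) (l - d - 1 - c)) := fun h ↦ by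
    rw [h]
    exact ⟨le_top, fun hl ↦ absurd (WithBot.coe_injective hl) (ENat.natCast_ne_top l)⟩
  rcases cases_pd M hM' with h1 | ⟨d, hd⟩
  · refine htop ?_
    rcases cases_pd _ hD' with h2 | ⟨e, he⟩
    · rw [h1, h2]; rfl
    · rw [h1, he]; rfl
  rcases cases_pd _ hD' with h2 | ⟨e, he⟩
  · refine htop ?_
    rw [hd, h2]
    exact congrArg WithBot.some (show (d : ℕ∞) + ⊤ + 1 + c = ⊤ by simp)
  rw [hd, he]
  have hdM : HasProjectiveDimensionLE (ModuleCat.of R M) d :=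
    (projectiveDimension_le_iff _ _).mp hd.le
  have heD : HasProjectiveDimensionLE (ModuleCat.of R (Module.Dual R M)) e :=
    (projectiveDimension_le_iff _ _).mp he.le
  have hdDD : HasProjectiveDimensionLE (ModuleCat.of R (Module.Dual R (Module.Dual R M))) d :=
    hasProjectiveDimensionLT_of_iso (Module.evalEquiv R M).toModuleIso _
  have hle : l ≤ d + e + 1 + c := by
    by_contra! hlt
    refine hM' (Module.projective_of_subsingleton_ext (ModuleCat.of R M) d hdM fun j h1 h2 ↦ ?_)
    obtain ⟨j, rfl⟩ := Nat.exists_eq_add_of_le' h1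
    exact Module.subsingleton_ext_of_hasProjectiveDimensionLE_dual (l - c) d e M hdepthM heD
      (by omega) j (by omega)
  refine ⟨by exact_mod_cast hle, fun heq ↦ ?_⟩
  have heq : l = d + e + 1 + c := by exact_mod_cast heq
  have hle' : l - d - 1 - c = e := by omega
  refine ⟨d, rfl, by omega, ⟨hd.le, fun i h1 h2 ↦ ?_⟩, ?_⟩
  · obtain ⟨j, rfl⟩ := Nat.exists_eq_add_of_le' h1
    -- Here `l - c = d + e + 1`, so `k = d - 1` is the largest admissible value; `1 ≤ i < d` rules
    -- out truncation at `d = 0`.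
    exact Module.subsingleton_ext_of_hasProjectiveDimensionLE_dual (l - c) (d - 1) e M hdepthM heD
      (by omega) j (by omega)
  · rw [hle']
    refine ⟨he.le, fun i h1 h2 ↦ ?_⟩
    obtain ⟨j, rfl⟩ := Nat.exists_eq_add_of_le' h1
    exact Module.subsingleton_ext_of_hasProjectiveDimensionLE_dual (l - c) (e - 1) d
      (Module.Dual R M) hdepthD hdDD (by omega) j (by omega)
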